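/- **Block Lemma.** Let $k\ge 2$ be an integer and let $n=2k-1$. Write $\langle S\rangle$ for the convex hull of $S$. For an $n$-simplex $\Delta$ let $\partial\Delta$ be its boundary (the union of its facets). A *modular block* is a set $\Omega=\overline{\Delta_0-\Delta_1-\Delta_2}$, where $\Delta_0$ is an $n$-simplex and $\Delta_1,\Delta_2\subset\Delta_0$ are $n$-simplices with disjoint interiors, such that 1. for all $i\ne j$ in $\{0,1,2\}$, the simplices $\Delta_i$ and $\Delta_j$ have exactly $k$ vertices in common, and $\partial\Delta_i\cap\partial\Delta_j$ is the convex hull of these common vertices; 2. $\partial\Delta_0,\partial\Delta_1,\partial\Delta_2\subset\Omega$, and there is a PL homeomorphism $\sigma:\Omega\to\Omega$ of order $3$ (that is, $\Omega$ has a finite triangulation on each simplex of which $\sigma$ is affine) which on each $\partial\Delta_j$ is the restriction of an affine map and satisfies $\sigma(\partial\Delta_0)=\partial\Delta_1$, $\sigma(\partial\Delta_1)=\partial\Delta_2$, $\sigma(\partial\Delta_2)=\partial\Delta_0$. The sets $\partial\Delta_j$ are the terminals of $\Omega$, and $\partial\Delta_0$ is the outer terminal. Let $\Delta_+$ be the convex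 hull of the standard basis vectors of $\mathbb R^{2k}=\mathbb R^k\times\mathbb R^k$. Let $e_1,\dots,e_k$ be the standard basis of $\mathbb R^k$, write $r_{(k)}=(r,\dots,r)\in\mathbb R^k$, and for $1\le j\le k$ put $$A_j=(e_j,0_{(k)}),\qquad B_j=\tfrac1{2n}\,(2_{(k)}-e_j,\;2_{(k)}-e_j),\qquad C_j=(0_{(k)},e_j),$$ and $A=\{A_j\}$, $B=\{B_j\}$, $C=\{C_j\}$. Call a $2k$-element subset $S\subset A\cup B\cup C$ *good* if it contains none of the triples $\{A_j,B_j,C_j\}$ and $S\neq A\cup C$. Then: (a) There is a modular block whose outer terminal is $\partial\Delta_+$; more precisely, $\Delta_0=\Delta_+$, $\Delta_1=\langle A\cup B\rangle$, $\Delta_2=\langle B\cup C\rangle$ define one. (b) There are exactly $3^k-1$ good sets, each is the vertex set of an $n$-simplex, and the simplices $\langle S\rangle$, $S$ good, are the maximal simplices of a triangulation of $\Delta_+$. -/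

import Mathlib

namespace ModularBlock

section General

variable {E : Type*} [AddCommGroup E] [Module ℝ E]

/-- The finite set `s` is the vertex set of an `n`-simplex: it consists of `n + 1` affinely
independent points. The simplex itself is `convexHull ℝ s`. -/
def IsSimplex (n : ℕ) (s : Finset E) : Prop :=
  s.card = n + 1 ∧ AffineIndependent ℝ ((↑) : s → E)

/-- The boundary of the simplex with vertex set `s`: the union of the faces opposite to the
vertices. -/
def bdry (s : Finset E) : Set E :=
  ⋃ v ∈ s, convexHull ℝ ((s : Set E) \ {v})

/-- The interior of the simplex with vertex set `s` (relative to its affine span). -/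
def inner (s : Finset E) : Set E :=
  convexHull ℝ (s : Set E) \ bdry s

variable [TopologicalSpace E]

/-- `closure (Δ₀ - Δ₁ - Δ₂)`, where `Δⱼ` is the simplex with vertex set `V j`. -/
def region (V : Fin 3 → Finset E) : Set E :=
  closure ((convexHull ℝ (V 0 : Set E) \ convexHull ℝ (V 1 : Set E)) \
    convexHull ℝ (V 2 : Set E))

/-- A homeomorphism `σ` of a set `Ω` is piecewise linear if `Ω` has a triangulation into finitely
many simplices on each of which `σ` is affine. -/
def IsPL {Ω : Set E} (σ : Ω ≃ₜ Ω) : Prop :=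
  ∃ K : Geometry.SimplicialComplex ℝ E, K.faces.Finite ∧ K.space = Ω ∧
    ∀ s ∈ K.faces, ∃ f : E →ᵃ[ℝ] E, ∀ x : Ω, (x : E) ∈ convexHull ℝ (s : Set E) →
      (σ x : E) = f x

/-- The simplices `Δ₀, Δ₁, Δ₂` with vertex sets `V 0, V 1, V 2` define a modular block
`Ω = closure (Δ₀ - Δ₁ - Δ₂)` of dimension `n = 2 k - 1`, with terminals `∂Δ₀` (outer), `∂Δ₁` and
`∂Δ₂` (inner). Indices are taken modulo 3. -/
structure IsModularBlock (k : ℕ) (V : Fin 3 → Finset E) : Prop where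
  isSimplex : ∀ j, IsSimplex (2 * k - 1) (V j)
  subset : ∀ j, convexHull ℝ (V j : Set E) ⊆ convexHull ℝ (V 0 : Set E)
  disjoint_inner : Disjoint (inner (V 1)) (inner (V 2))
  card_common : ∀ i j, i ≠ j → ((V i : Set E) ∩ (V j : Set E)).ncard = k
  bdry_inter : ∀ i j, i ≠ j → bdry (V i) ∩ bdry (V j) = convexHull ℝ ((V i : Set E) ∩ (V j : Set E))
  bdry_subset : ∀ j, bdry (V j) ⊆ region V
  exists_symm : ∃ σ : region V ≃ₜ region V, orderOf σ = 3 ∧ IsPL σ ∧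
    ∀ j, ∃ f : E →ᵃ[ℝ] E, (∀ x : region V, (x : E) ∈ bdry (V j) → (σ x : E) = f x) ∧
      f '' bdry (V j) = bdry (V (j + 1))

end General

section Model

/-- The space `ℝ²ᵏ = ℝᵏ × ℝᵏ`. -/
abbrev Space (k : ℕ) : Type := Fin k ⊕ Fin k → ℝ

/-- `A j = (e_j, 0)`. -/
noncomputable def ptA (k : ℕ) (j : Fin k) : Space k :=
  Sum.elim (Pi.single j 1) (fun _ => 0)

/-- `B j = (1 / 2n) (2 - e_j, 2 - e_j)` with `n = 2 k - 1`. -/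
noncomputable def ptB (k : ℕ) (j : Fin k) : Space k :=
  (1 / (2 * (2 * (k : ℝ) - 1))) •
    Sum.elim ((fun _ => 2) - Pi.single j 1) ((fun _ => 2) - Pi.single j 1)

/-- `C j = (0, e_j)`. -/
noncomputable def ptC (k : ℕ) (j : Fin k) : Space k :=
  Sum.elim (fun _ => 0) (Pi.single j 1)

/-- The set `A = {A 1, …, A k}`. -/
noncomputable def setA (k : ℕ) : Finset (Space k) := Finset.univ.image (ptA k)

/-- The set `B = {B 1, …, B k}`. -/
noncomputable def setB (k : ℕ) : Finset (Space k) := Finset.univ.image (ptB k)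

/-- The set `C = {C 1, …, C k}`. -/
noncomputable def setC (k : ℕ) : Finset (Space k) := Finset.univ.image (ptC k)

/-- The vertex set of the standard simplex `Δ₊`: the standard basis vectors of `ℝ²ᵏ`. -/
noncomputable def stdVertices (k : ℕ) : Finset (Space k) :=
  Finset.univ.image fun i => Pi.single i 1

/-- A set of `2 k` points of `A ∪ B ∪ C` is good if it contains no triple `{A j, B j, C j}` and
is not `A ∪ C`. -/
def IsGood (k : ℕ) (S : Finset (Space k)) : Prop :=
  S ⊆ setA k ∪ setB k ∪ setC k ∧ S.card = 2 * k ∧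
    (∀ j, ¬ (ptA k j ∈ S ∧ ptB k j ∈ S ∧ ptC k j ∈ S)) ∧ S ≠ setA k ∪ setC k

end Model

end ModularBlock

/-! A set of `2k` points containing no triple `{A_i, B_i, C_i}` omits exactly one point of each
triple, so it is the complement of the graph of a function `g : Fin k → Fin 3`; good sets correspond
to `g` not constantly `1`. The work takes place in the space of barycentric weights `w` on `Fin k ×
Fin 3`: both the triangulation and the block are images under `comb (pt k)` of explicit unions of
faces.

Let `β_i = w (i, 1)`, `b = ∑ β_i` and `d_i = min (w (i, 0)) (w (i, 2))`. The points `B_j` contribute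
equally to the two coordinates with index `i`, so the smaller coordinate `m_i` satisfies `2n m_i =
2n d_i + 2b - β_i` (`mul_min_comb_pt`). Membership in a good face makes `d_i` and `β_i`
complementary, with some `d_i = 0`. Hence `β_i = max (2b - 2n m_i) 0`, and everything reduces to one
scalar equation for `b`. Its uniqueness gives `injOn_comb_pt`, its solvability gives
`image_comb_pt`, and together they triangulate `Δ₊`.

The simplices `Δ₀, Δ₁, Δ₂` omit the graphs of the constants `1, 2, 0`, that is, `j + 1` for `Δⱼ`.
Removing `Δ₁` and `Δ₂` from the triangulation leaves the simplices of nonconstant `g`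
(`region_terminal`). This family is invariant under the cyclic shift `A → B → C → A`, and permuting
weights accordingly gives the symmetry of order 3. -/

namespace ModularBlock

open Finset Set Filter Topology

/-! ### Convex combinations, simplicial complexes and maps described by barycentric weights. -/

section Weights

variable {ι E E' : Type*} [Fintype ι] [AddCommGroup E] [Module ℝ E]
  [AddCommGroup E'] [Module ℝ E']

/-- The barycentric weights supported on the index set `S`. -/
def faceWeights (S : Finset ι) : Set (ι → ℝ) :=
  {w | w ∈ stdSimplex ℝ ι ∧ ∀ i ∉ S, w i = 0}

/-- The barycentric weights supported on some member of the family `G`. -/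
def familyWeights (G : Set (Finset ι)) : Set (ι → ℝ) :=
  ⋃ S ∈ G, faceWeights S

/-- The linear combination of the points `p i` with given weights. -/
noncomputable abbrev comb (p : ι → E) : (ι → ℝ) →ₗ[ℝ] E := Fintype.linearCombination ℝ p

theorem faceWeights_mono {S T : Finset ι} (h : S ⊆ T) : faceWeights S ⊆ faceWeights T :=
  fun _ hw => ⟨hw.1, fun i hi => hw.2 i fun hS => hi (h hS)⟩

theorem faceWeights_subset_familyWeights {G : Set (Finset ι)} {S : Finset ι} (h : S ∈ G) :
    faceWeights S ⊆ familyWeights G :=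
  Set.subset_biUnion_of_mem (u := fun S => faceWeights S) h

theorem single_mem_faceWeights [DecidableEq ι] {S : Finset ι} {i : ι} (h : i ∈ S) :
    Pi.single i 1 ∈ faceWeights S :=
  ⟨single_mem_stdSimplex ℝ i, fun j hj => Pi.single_eq_of_ne (by rintro rfl; exact hj h) _⟩

theorem faceWeights_inter [DecidableEq ι] (S T : Finset ι) :
    faceWeights (S ∩ T) = faceWeights S ∩ faceWeights T := by
  refine (Set.subset_inter (faceWeights_mono Finset.inter_subset_left)
    (faceWeights_mono Finset.inter_subset_right)).antisymm ?_
  rintro w ⟨h, h'⟩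
  refine ⟨h.1, fun i hi => ?_⟩
  rw [Finset.mem_inter, not_and_or] at hi
  exact hi.elim (h.2 i) (h'.2 i)

theorem convex_faceWeights (S : Finset ι) : Convex ℝ (faceWeights S) := by
  intro u hu v hv a b ha hb hab
  refine ⟨convex_stdSimplex ℝ ι hu.1 hv.1 ha hb hab, fun i hi => ?_⟩
  simp [hu.2 i hi, hv.2 i hi]

theorem isCompact_faceWeights (S : Finset ι) : IsCompact (faceWeights S) := by
  refine (isCompact_stdSimplex ℝ ι).of_isClosed_subset ?_ fun w hw => hw.1
  have : faceWeights S = stdSimplex ℝ ι ∩ ⋂ i ∈ {i | i ∉ S}, {w | w i = 0} := by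
    ext w; simp [faceWeights]
  rw [this]
  exact (isClosed_stdSimplex ℝ ι).inter <| isClosed_biInter fun i _ =>
    isClosed_eq (continuous_apply i) continuous_const

theorem isCompact_familyWeights (G : Set (Finset ι)) : IsCompact (familyWeights G) :=
  G.toFinite.isCompact_biUnion fun S _ => isCompact_faceWeights S

theorem comb_eq_sum (p : ι → E) {S : Finset ι} {w : ι → ℝ} (hw : ∀ i ∉ S, w i = 0) :
    comb p w = ∑ i ∈ S, w i • p i := by
  rw [Fintype.linearCombination_apply]
  exact (Finset.sum_subset (Finset.subset_univ S) fun i _ hi => by rw [hw i hi, zero_smul]).symm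

/-- The convex hull of finitely many points is the set of their convex combinations. -/
theorem convexHull_image_eq (p : ι → E) (S : Finset ι) :
    convexHull ℝ (p '' S) = comb p '' faceWeights S := by
  classical
  refine (convexHull_min ?_ ((convex_faceWeights S).linear_image _)).antisymm ?_
  · rintro _ ⟨i, hi, rfl⟩
    exact ⟨_, single_mem_faceWeights hi, by simp⟩
  · rintro _ ⟨w, hw, rfl⟩
    rw [comb_eq_sum p hw.2]
    refine (convex_convexHull ℝ _).sum_mem (fun i _ => hw.1.1 i) ?_ fun i hi =>
      subset_convexHull ℝ _ ⟨i, hi, rfl⟩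
    rw [← hw.1.2]
    exact Finset.sum_subset (Finset.subset_univ S) fun i _ hi => hw.2 i hi

/-- The positive and negative parts of `u` have the same total mass `s`. If `s > 0`, dividing by `s`
yields two weights on `S` with the same combination, so injectivity makes them equal. -/
theorem eq_zero_of_injOn_faceWeights {p : ι → E} {S : Finset ι}
    (h : InjOn (comb p) (faceWeights S)) {u : ι → ℝ} (hS : ∀ i ∉ S, u i = 0)
    (hsum : ∑ i, u i = 0) (hu : comb p u = 0) : u = 0 := by
  set s := ∑ i, (u i)⁺ with hs
  have hneg : ∑ i, (u i)⁻ = s := by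
    have : ∑ i, ((u i)⁺ - (u i)⁻) = 0 := by simpa only [posPart_sub_negPart] using hsum
    rw [Finset.sum_sub_distrib] at this
    linarith
  rcases (Finset.sum_nonneg fun i _ => posPart_nonneg (u i) : 0 ≤ s).eq_or_lt with h0 | h0
  · have h1 := (Finset.sum_eq_zero_iff_of_nonneg fun i _ => posPart_nonneg (u i)).1 h0.symm
    have h2 := (Finset.sum_eq_zero_iff_of_nonneg fun i _ => negPart_nonneg (u i)).1
      (hneg.trans h0.symm)
    funext i
    have := posPart_sub_negPart (u i)
    rw [h1 i (Finset.mem_univ i), h2 i (Finset.mem_univ i)] at this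
    simpa using this.symm
  · have hp : s⁻¹ • (fun i => (u i)⁺) ∈ faceWeights S := by
      refine ⟨⟨fun i => mul_nonneg (inv_nonneg.2 h0.le) (posPart_nonneg _), ?_⟩, fun i hi => ?_⟩
      · simp only [Pi.smul_apply, smul_eq_mul, ← Finset.mul_sum, ← hs]
        exact inv_mul_cancel₀ h0.ne'
      · simp [hS i hi]
    have hn : s⁻¹ • (fun i => (u i)⁻) ∈ faceWeights S := by
      refine ⟨⟨fun i => mul_nonneg (inv_nonneg.2 h0.le) (negPart_nonneg _), ?_⟩, fun i hi => ?_⟩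
      · simp only [Pi.smul_apply, smul_eq_mul, ← Finset.mul_sum, hneg]
        exact inv_mul_cancel₀ h0.ne'
      · simp [hS i hi]
    have hdecomp : u = (fun i => (u i)⁺) - fun i => (u i)⁻ := by
      funext i; simp [posPart_sub_negPart]
    have heq := h hp hn <| by
      rw [map_smul, map_smul]
      congr 1
      rw [← sub_eq_zero, ← map_sub, ← hdecomp, hu]
    have := smul_right_injective _ (inv_ne_zero h0.ne') heq
    rw [hdecomp, this, sub_self]

theorem affineIndependent_of_injOn_faceWeights {p : ι → E} {S : Finset ι}
    (h : InjOn (comb p) (faceWeights S)) : AffineIndependent ℝ (fun i : S => p i) := by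
  classical
  rw [affineIndependent_iff]
  intro t w hw hwp i hi
  let u : ι → ℝ := fun j => if hj : j ∈ S then (if (⟨j, hj⟩ : S) ∈ t then w ⟨j, hj⟩ else 0) else 0
  have hu0 : ∀ j ∉ S, u j = 0 := fun j hj => dif_neg hj
  have huS : ∀ j : S, u j = if j ∈ t then w j else 0 := fun j => by simp [u]
  have hu : u = 0 := by
    refine eq_zero_of_injOn_faceWeights h hu0 ?_ ?_
    · rw [← Finset.sum_subset (Finset.subset_univ S) fun j _ hj => hu0 j hj, ← Finset.sum_coe_sort]
      simp only [huS, Finset.sum_ite_mem, Finset.univ_inter, hw]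
    · rw [comb_eq_sum p hu0, ← Finset.sum_coe_sort]
      simp only [huS, ite_smul, zero_smul, Finset.sum_ite_mem, Finset.univ_inter, hwp]
  have := huS i
  rw [hu, if_pos hi] at this
  exact this.symm

theorem affineIndependent_coe_image [DecidableEq E] {p : ι → E} {S : Finset ι}
    (h : InjOn (comb p) (faceWeights S)) :
    AffineIndependent ℝ ((↑) : S.image p → E) := by
  have := (affineIndependent_of_injOn_faceWeights h).range
  have hr : Set.range (fun i : S => p i) = (S.image p : Finset E) := by
    ext x; simp
  rw [hr] at this
  exact this

/-- The geometric simplicial complex spanned by points `p i` such that weights supported on members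
of `G` are determined by the corresponding convex combination. -/
@[simps] noncomputable def complexOfFamily [DecidableEq E] (p : ι → E) (hp : p.Injective)
    (G : Set (Finset ι)) (h : InjOn (comb p) (familyWeights G)) :
    Geometry.SimplicialComplex ℝ E where
  faces := {s | ∃ S T : Finset ι, T ∈ G ∧ S ⊆ T ∧ S.Nonempty ∧ s = S.image p}
  isRelLowerSet_faces := by
    rintro _ ⟨S, T, hT, hST, hS, rfl⟩
    refine ⟨hS.image p, fun t ht htn => ?_⟩
    obtain ⟨S', hS', rfl⟩ := Finset.subset_image_iff.1 ht
    exact ⟨S', T, hT, (Finset.coe_subset.1 hS').trans hST, (Finset.image_nonempty.1 htn), rfl⟩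
  indep := by
    rintro _ ⟨S, T, hT, hST, hS, rfl⟩
    exact affineIndependent_coe_image
      (h.mono ((faceWeights_mono hST).trans (faceWeights_subset_familyWeights hT)))
  inter_subset_convexHull := by
    classical
    rintro _ _ ⟨S, T, hT, hST, hS, rfl⟩ ⟨S', T', hT', hST', hS', rfl⟩ x ⟨hx, hx'⟩
    rw [Finset.coe_image, convexHull_image_eq] at hx hx'
    obtain ⟨w, hw, rfl⟩ := hx
    obtain ⟨w', hw', e⟩ := hx'
    have := h (faceWeights_subset_familyWeights hT' (faceWeights_mono hST' hw'))
      (faceWeights_subset_familyWeights hT (faceWeights_mono hST hw)) e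
    subst this
    rw [Finset.coe_image, Finset.coe_image, ← Set.image_inter hp, ← Finset.coe_inter,
      convexHull_image_eq]
    rw [faceWeights_inter]
    exact ⟨w', ⟨hw, hw'⟩, rfl⟩

theorem complexOfFamily_space [DecidableEq E] (p : ι → E) (hp : p.Injective)
    (G : Set (Finset ι)) (h : InjOn (comb p) (familyWeights G)) :
    (complexOfFamily p hp G h).space = comb p '' familyWeights G := by
  ext x
  simp only [Geometry.SimplicialComplex.mem_space_iff, complexOfFamily_faces]
  constructor
  · rintro ⟨_, ⟨S, T, hT, hST, hS, rfl⟩, hx⟩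
    rw [Finset.coe_image, convexHull_image_eq] at hx
    exact Set.image_mono ((faceWeights_mono hST).trans (faceWeights_subset_familyWeights hT)) hx
  · rintro ⟨w, hw, rfl⟩
    obtain ⟨T, hT, hw⟩ := Set.mem_iUnion₂.1 hw
    refine ⟨_, ⟨T, T, hT, subset_rfl, ?_, rfl⟩, ?_⟩
    · by_contra hne
      rw [Finset.not_nonempty_iff_eq_empty] at hne
      have := hw.1.2
      rw [Finset.sum_eq_zero fun i _ => hw.2 i (by simp [hne])] at this
      exact zero_ne_one this
    · rw [Finset.coe_image, convexHull_image_eq]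
      exact ⟨w, hw, rfl⟩

theorem complexOfFamily_faces_finite [DecidableEq E] (p : ι → E) (hp : p.Injective)
    (G : Set (Finset ι)) (h : InjOn (comb p) (familyWeights G)) :
    (complexOfFamily p hp G h).faces.Finite := by
  refine (Set.finite_range fun S : Finset ι => S.image p).subset ?_
  rintro _ ⟨S, T, hT, hST, hS, rfl⟩
  exact ⟨S, rfl⟩

/-- Members of equal cardinality cannot contain one another properly, so all are maximal. Positivity
of `m` matters because the empty set is not a face. -/
theorem complexOfFamily_facets [DecidableEq E] (p : ι → E) (hp : p.Injective)
    (G : Set (Finset ι)) (h : InjOn (comb p) (familyWeights G)) {m : ℕ} (hm : 0 < m)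
    (hG : ∀ T ∈ G, T.card = m) :
    (complexOfFamily p hp G h).facets = (fun T : Finset ι => T.image p) '' G := by
  ext s
  simp only [Geometry.SimplicialComplex.mem_facets, complexOfFamily_faces]
  constructor
  · rintro ⟨⟨S, T, hT, hST, hS, rfl⟩, hmax⟩
    exact ⟨T, hT, (hmax _ ⟨T, T, hT, subset_rfl, hS.mono hST, rfl⟩
      (Finset.image_subset_image hST)).symm⟩
  · rintro ⟨T, hT, rfl⟩
    refine ⟨⟨T, T, hT, subset_rfl, Finset.card_pos.1 (hG T hT ▸ hm), rfl⟩, ?_⟩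
    rintro _ ⟨S, T', hT', hST', hS, rfl⟩ hsub
    refine Finset.eq_of_subset_of_card_le hsub ?_
    rw [Finset.card_image_of_injective _ hp, Finset.card_image_of_injective _ hp, hG T hT,
      ← hG T' hT']
    exact Finset.card_le_card hST'

/-- Prescribed values on an affinely independent family extend to an affine map. -/
theorem exists_affineMap_of_affineIndependent {κ : Type*} {p : κ → E}
    (hp : AffineIndependent ℝ p) (q : κ → E') : ∃ f : E →ᵃ[ℝ] E', ∀ i, f (p i) = q i := by
  rcases isEmpty_or_nonempty κ with hκ | ⟨⟨i₀⟩⟩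
  · exact ⟨AffineMap.const ℝ E 0, fun i => (hκ.false i).elim⟩
  have hli := (affineIndependent_iff_linearIndependent_vsub ℝ p i₀).1 hp
  obtain ⟨L, hL⟩ := ((Module.Basis.span hli).constr ℝ fun i => q i - q i₀).exists_extend
  refine ⟨⟨fun x => L (x - p i₀) + q i₀, L, fun x v => ?_⟩, fun i => ?_⟩
  · simp only [vadd_eq_add, map_add, add_sub_assoc, add_assoc]
  · by_cases hi : i = i₀
    · subst hi; simp
    · have h1 : (p i - p i₀ : E) = (Module.Basis.span hli ⟨i, hi⟩ : E) := by
        rw [Module.Basis.span_apply]; rfl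
      have h2 := LinearMap.congr_fun hL (Module.Basis.span hli ⟨i, hi⟩)
      rw [Module.Basis.constr_basis, LinearMap.comp_apply, Submodule.subtype_apply, ← h1] at h2
      change L (p i - p i₀) + q i₀ = q i
      rw [h2, sub_add_cancel]

/-- An affine map carrying `p i` to `q i` for `i ∈ S` carries convex combinations of the `p i` to
those of the `q i`. -/
theorem exists_affineMap_comb {p : ι → E} {S : Finset ι}
    (h : InjOn (comb p) (faceWeights S)) (q : ι → E') :
    ∃ f : E →ᵃ[ℝ] E', ∀ w ∈ faceWeights S, f (comb p w) = comb q w := by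
  obtain ⟨f, hf⟩ := exists_affineMap_of_affineIndependent
    (affineIndependent_of_injOn_faceWeights h) fun i : S => q i
  refine ⟨f, fun w hw => ?_⟩
  have hsum : ∑ i ∈ S, w i = 1 := by
    rw [← hw.1.2]
    exact Finset.sum_subset (Finset.subset_univ S) fun i _ hi => hw.2 i hi
  rw [comb_eq_sum p hw.2, comb_eq_sum q hw.2,
    ← S.affineCombination_eq_linear_combination p w hsum, S.map_affineCombination p w hsum f,
    S.affineCombination_eq_linear_combination _ w hsum]
  exact Finset.sum_congr rfl fun i hi => by rw [Function.comp_apply, hf ⟨i, hi⟩]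

theorem comb_comp_symm (p : ι → E) (ρ : Equiv.Perm ι) (w : ι → ℝ) :
    comb p (w ∘ ρ.symm) = comb (p ∘ ρ) w := by
  simp only [Fintype.linearCombination_apply, Function.comp_apply]
  rw [← Equiv.sum_comp ρ]
  simp

/-- A symmetry of a compact set of weights induces a homeomorphism of the set of corresponding
convex combinations. -/
theorem exists_homeomorph_comb [TopologicalSpace E] [IsTopologicalAddGroup E] [ContinuousSMul ℝ E]
    [T2Space E] {p : ι → E} {W : Set (ι → ℝ)} (hW : IsCompact W) (h : InjOn (comb p) W)
    {Ω : Set E} (hΩ : Ω = comb p '' W) (ρ : Equiv.Perm ι) (hρ : ∀ w ∈ W, w ∘ ρ.symm ∈ W)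
    (hρ' : ∀ w ∈ W, w ∘ ρ ∈ W) :
    ∃ σ : Ω ≃ₜ Ω, ∀ x : Ω, ∀ w ∈ W, (x : E) = comb p w → (σ x : E) = comb p (w ∘ ρ.symm) := by
  subst hΩ
  have := isCompact_iff_compactSpace.1 hW
  have hc : Continuous (comb p) := LinearMap.continuous_on_pi _
  let e₀ : W ≃ comb p '' W := Equiv.Set.imageOfInjOn _ _ h
  have he₀ : Continuous e₀ := (hc.comp continuous_subtype_val).subtype_mk _
  let e : W ≃ₜ comb p '' W := he₀.homeoOfEquivCompactToT2
  let r : W ≃ₜ W :=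
    { toFun := fun w => ⟨w.1 ∘ ρ.symm, hρ w.1 w.2⟩
      invFun := fun w => ⟨w.1 ∘ ρ, hρ' w.1 w.2⟩
      left_inv := fun w => Subtype.ext <| funext fun i => by simp
      right_inv := fun w => Subtype.ext <| funext fun i => by simp
      continuous_toFun := by
        refine Continuous.subtype_mk (continuous_pi fun i => ?_) _
        exact (continuous_apply (ρ.symm i)).comp continuous_subtype_val
      continuous_invFun := by
        refine Continuous.subtype_mk (continuous_pi fun i => ?_) _
        exact (continuous_apply (ρ i)).comp continuous_subtype_val }
  refine ⟨(e.symm.trans r).trans e, fun x w hw hx => ?_⟩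
  have : e.symm x = ⟨w, hw⟩ := by
    rw [Homeomorph.symm_apply_eq]
    exact Subtype.ext hx
  rw [Homeomorph.trans_apply, Homeomorph.trans_apply, this]
  rfl

theorem bdry_image [DecidableEq ι] [DecidableEq E] {p : ι → E} (hp : p.Injective) (S : Finset ι) :
    bdry (S.image p) = comb p '' ⋃ i ∈ S, faceWeights (S.erase i) := by
  simp only [bdry, Finset.set_biUnion_finset_image, Set.image_iUnion₂]
  refine Set.iUnion₂_congr fun i _ => ?_
  rw [← convexHull_image_eq, Finset.coe_image, Finset.coe_erase, Set.image_sdiff hp,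
    Set.image_singleton]

end Weights

/-! ### The weights of good faces correspond bijectively to the points of the standard simplex. -/

section Points

variable {k : ℕ}

/-- The points of `A ∪ B ∪ C`, indexed by `Fin k × Fin 3`. -/
noncomputable def pt (k : ℕ) (i : Fin k × Fin 3) : Space k :=
  ![ptA k i.1, ptB k i.1, ptC k i.1] i.2

theorem pt_zero (i : Fin k) : pt k (i, 0) = ptA k i := rfl

theorem pt_one (i : Fin k) : pt k (i, 1) = ptB k i := rfl

theorem pt_two (i : Fin k) : pt k (i, 2) = ptC k i := rfl

/-- The indices that are not on the graph of `g`. -/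
def avoid (g : Fin k → Fin 3) : Finset (Fin k × Fin 3) :=
  univ.filter fun i => i.2 ≠ g i.1

@[simp] theorem mem_avoid {g : Fin k → Fin 3} {i : Fin k × Fin 3} :
    i ∈ avoid g ↔ i.2 ≠ g i.1 := by
  simp [avoid]

theorem card_avoid (g : Fin k → Fin 3) : (avoid g).card = 2 * k := by
  have h : ∀ a : Fin 3, ∑ j : Fin 3, (if j ≠ a then 1 else 0) = 2 := by decide
  rw [avoid, Finset.card_filter, Fintype.sum_prod_type]
  simp only [h, Finset.sum_const, Finset.card_univ, Fintype.card_fin, smul_eq_mul, mul_comm]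

theorem avoid_injective : Function.Injective (avoid (k := k)) := by
  intro g g' h
  funext i
  by_contra hne
  have : (i, g i) ∈ avoid g' := mem_avoid.2 hne
  rw [← h, mem_avoid] at this
  exact this rfl

/-- Weights vanishing on the graph of some function in `P`. -/
abbrev graphWeights (P : Set (Fin k → Fin 3)) : Set (Fin k × Fin 3 → ℝ) :=
  familyWeights (avoid '' P)

theorem mem_graphWeights {P : Set (Fin k → Fin 3)} {w : Fin k × Fin 3 → ℝ} :
    w ∈ graphWeights P ↔ w ∈ stdSimplex ℝ _ ∧ ∃ g ∈ P, ∀ i, w (i, g i) = 0 := by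
  simp only [graphWeights, familyWeights, Set.biUnion_image, Set.mem_iUnion, exists_prop,
    faceWeights, Set.mem_ofPred_eq, mem_avoid, not_not]
  constructor
  · rintro ⟨g, hg, hw, h⟩
    exact ⟨hw, g, hg, fun i => h _ rfl⟩
  · rintro ⟨hw, g, hg, h⟩
    refine ⟨g, hg, hw, fun i hi => ?_⟩
    have := h i.1
    rwa [← hi] at this

theorem graphWeights_mono {P Q : Set (Fin k → Fin 3)} (h : P ⊆ Q) :
    graphWeights P ⊆ graphWeights Q :=
  Set.biUnion_subset_biUnion_left (Set.image_mono h)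

theorem comb_pt_inl (w : Fin k × Fin 3 → ℝ) (i : Fin k) :
    comb (pt k) w (Sum.inl i) =
      w (i, 0) + 1 / (2 * (2 * (k : ℝ) - 1)) * (2 * ∑ j, w (j, 1) - w (i, 1)) := by
  simp only [Fintype.linearCombination_apply, Fintype.sum_prod_type, Fin.sum_univ_three, pt_zero,
    pt_one, pt_two, ptA, ptB, ptC, Finset.sum_apply, Pi.smul_apply, Sum.elim_inl,
    smul_eq_mul, Pi.sub_apply, Finset.sum_add_distrib, mul_sub, Finset.sum_sub_distrib,
    Finset.mul_sum, Pi.single_apply]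
  simp only [one_div, mul_ite, mul_one, mul_zero, Finset.sum_ite_eq, Finset.mem_univ, if_true,
    Finset.sum_const_zero, add_zero]
  ring_nf
  simp only [mul_comm]

theorem comb_pt_inr (w : Fin k × Fin 3 → ℝ) (i : Fin k) :
    comb (pt k) w (Sum.inr i) =
      w (i, 2) + 1 / (2 * (2 * (k : ℝ) - 1)) * (2 * ∑ j, w (j, 1) - w (i, 1)) := by
  simp only [Fintype.linearCombination_apply, Fintype.sum_prod_type, Fin.sum_univ_three, pt_zero,
    pt_one, pt_two, ptA, ptB, ptC, Finset.sum_apply, Pi.smul_apply, Sum.elim_inr,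
    smul_eq_mul, Pi.sub_apply, Finset.sum_add_distrib, mul_sub, Finset.sum_sub_distrib,
    Finset.mul_sum, Pi.single_apply]
  simp only [one_div, mul_ite, mul_one, mul_zero, Finset.sum_ite_eq, Finset.mem_univ, if_true,
    Finset.sum_const_zero, zero_add]
  ring_nf
  simp only [mul_comm]
  ring

/-- The `B`-contribution is the same in both coordinates with index `i`, so it passes through the
minimum. This eliminates the `A` and `C` weights except for their minimum. -/
theorem mul_min_comb_pt (hk : 2 ≤ k) (w : Fin k × Fin 3 → ℝ) (i : Fin k) :
    2 * (2 * (k : ℝ) - 1) * min (comb (pt k) w (Sum.inl i)) (comb (pt k) w (Sum.inr i)) =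
      2 * (2 * (k : ℝ) - 1) * min (w (i, 0)) (w (i, 2)) + 2 * ∑ j, w (j, 1) - w (i, 1) := by
  have hk' : (2 : ℝ) ≤ k := by exact_mod_cast hk
  have : 2 * (k : ℝ) - 1 ≠ 0 := by linarith
  rw [comb_pt_inl, comb_pt_inr, min_add_add_right]
  field_simp
  ring

theorem sum_comb_pt (hk : 2 ≤ k) (w : Fin k × Fin 3 → ℝ) :
    ∑ i, comb (pt k) w i = ∑ i, w i := by
  have hk' : (2 : ℝ) ≤ k := by exact_mod_cast hk
  have : 2 * (k : ℝ) - 1 ≠ 0 := by linarith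
  simp only [Fintype.sum_sum_type, comb_pt_inl, comb_pt_inr, Fintype.sum_prod_type,
    Fin.sum_univ_three, Finset.sum_add_distrib, ← Finset.mul_sum, Finset.sum_sub_distrib,
    Finset.sum_const, Finset.card_univ, Fintype.card_fin, nsmul_eq_mul]
  generalize ∑ i, w (i, 1) = b
  field_simp
  ring

theorem comb_pt_mem_stdSimplex (hk : 2 ≤ k) {w : Fin k × Fin 3 → ℝ} (hw : w ∈ stdSimplex ℝ _) :
    comb (pt k) w ∈ stdSimplex ℝ (Fin k ⊕ Fin k) := by
  have hk' : (2 : ℝ) ≤ k := by exact_mod_cast hk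
  have h0 : 0 ≤ 1 / (2 * (2 * (k : ℝ) - 1)) := one_div_nonneg.2 (by linarith)
  have hb : ∀ i, 0 ≤ 2 * ∑ j, w (j, 1) - w (i, 1) := fun i => by
    have h1 := Finset.single_le_sum (f := fun j => w (j, 1)) (fun j _ => hw.1 (j, 1))
      (Finset.mem_univ i)
    have h2 := hw.1 (i, 1)
    linarith
  refine ⟨?_, by rw [sum_comb_pt hk, hw.2]⟩
  rintro (i | i)
  · rw [comb_pt_inl]; exact add_nonneg (hw.1 _) (mul_nonneg h0 (hb i))
  · rw [comb_pt_inr]; exact add_nonneg (hw.1 _) (mul_nonneg h0 (hb i))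

/-- The functions whose avoiding sets index the good sets. -/
abbrev goodGraphs (k : ℕ) : Set (Fin k → Fin 3) := {g | g ≠ fun _ => 1}

theorem min_mul_eq_zero_of_mem {w : Fin k × Fin 3 → ℝ} (hw : w ∈ graphWeights (goodGraphs k)) :
    (∀ i, w (i, 1) = 0 ∨ min (w (i, 0)) (w (i, 2)) = 0) ∧
      ∃ i, min (w (i, 0)) (w (i, 2)) = 0 := by
  obtain ⟨hs, g, hg, h⟩ := mem_graphWeights.1 hw
  have key : ∀ i, g i ≠ 1 → min (w (i, 0)) (w (i, 2)) = 0 := fun i hi => by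
    have h0 := hs.1 (i, 0)
    have h2 := hs.1 (i, 2)
    have hi' := h i
    generalize g i = a at hi hi'
    fin_cases a
    · exact (min_eq_left (hi'.trans_le h2)).trans hi'
    · exact absurd rfl hi
    · exact (min_eq_right (hi'.trans_le h0)).trans hi'
  constructor
  · intro i
    by_cases hi : g i = 1
    · left; have := h i; rwa [hi] at this
    · exact Or.inr (key i hi)
  · by_contra! hne
    exact hg (funext fun i => by_contra fun hi => hne i (key i hi))

/-- If the `B`-mass grew from `b` to `b' > b`, every `β_i` would weakly increase by complementarity.
At an index with `d_i = 0`, the increase would be at least `2 (b' - b)`, which exceeds the total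
increase `b' - b`. -/
theorem sum_weight_one_le (hk : 2 ≤ k) {w w' : Fin k × Fin 3 → ℝ}
    (hw : w ∈ graphWeights (goodGraphs k)) (hw' : w' ∈ graphWeights (goodGraphs k))
    (h : comb (pt k) w = comb (pt k) w') : ∑ j, w' (j, 1) ≤ ∑ j, w (j, 1) := by
  by_contra! hlt
  have hk' : (2 : ℝ) ≤ k := by exact_mod_cast hk
  have hn : 0 < 2 * (2 * (k : ℝ) - 1) := by linarith
  obtain ⟨hz, i₀, hi₀⟩ := min_mul_eq_zero_of_mem hw
  obtain ⟨hz', -⟩ := min_mul_eq_zero_of_mem hw'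
  have hs := (mem_graphWeights.1 hw).1.1
  have hs' := (mem_graphWeights.1 hw').1.1
  have heq : ∀ i, 2 * (2 * (k : ℝ) - 1) * min (w (i, 0)) (w (i, 2)) + 2 * ∑ j, w (j, 1) - w (i, 1) =
      2 * (2 * (k : ℝ) - 1) * min (w' (i, 0)) (w' (i, 2)) + 2 * ∑ j, w' (j, 1) - w' (i, 1) :=
    fun i => by rw [← mul_min_comb_pt hk, ← mul_min_comb_pt hk, h]
  have hd : ∀ i, 0 ≤ 2 * (2 * (k : ℝ) - 1) * min (w (i, 0)) (w (i, 2)) := fun i =>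
    mul_nonneg hn.le (le_min (hs _) (hs _))
  have hd' : ∀ i, 0 ≤ 2 * (2 * (k : ℝ) - 1) * min (w' (i, 0)) (w' (i, 2)) := fun i =>
    mul_nonneg hn.le (le_min (hs' _) (hs' _))
  have hmono : ∀ i, w (i, 1) ≤ w' (i, 1) := fun i => by
    rcases hz i with h1 | h1
    · rw [h1]; exact hs' _
    · have := heq i
      rw [h1] at this
      linarith [hd' i]
  have hstep := heq i₀
  rw [hi₀] at hstep
  have hi₁ := Finset.add_sum_erase univ (fun j => w (j, 1)) (Finset.mem_univ i₀)
  have hi₂ := Finset.add_sum_erase univ (fun j => w' (j, 1)) (Finset.mem_univ i₀)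
  have hi₃ := Finset.sum_le_sum fun j (_ : j ∈ univ.erase i₀) => hmono j
  linarith [hd' i₀]

theorem injOn_comb_pt (hk : 2 ≤ k) : InjOn (comb (pt k)) (graphWeights (goodGraphs k)) := by
  intro w hw w' hw' h
  have hk' : (2 : ℝ) ≤ k := by exact_mod_cast hk
  have hn : 0 < 2 * (2 * (k : ℝ) - 1) := by linarith
  have hb := (sum_weight_one_le hk hw' hw h.symm).antisymm (sum_weight_one_le hk hw hw' h)
  have hz := (min_mul_eq_zero_of_mem hw).1
  have hz' := (min_mul_eq_zero_of_mem hw').1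
  have hs := (mem_graphWeights.1 hw).1.1
  have hs' := (mem_graphWeights.1 hw').1.1
  -- With `b` known, `2n d_i - β_i` is known. Since `d_i` and `β_i` are nonnegative and one of them
  -- vanishes, they are determined as its positive and negative parts.
  have h1 : ∀ i, w (i, 1) = w' (i, 1) := fun i => by
    have heq := mul_min_comb_pt hk w i
    rw [h, mul_min_comb_pt hk w' i, hb] at heq
    have hd := mul_nonneg hn.le (le_min (hs (i, 0)) (hs (i, 2)))
    have hd' := mul_nonneg hn.le (le_min (hs' (i, 0)) (hs' (i, 2)))
    have := hs (i, 1)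
    have := hs' (i, 1)
    have h1 := (hz i).imp_right fun h => mul_eq_zero_of_right (2 * (2 * (k : ℝ) - 1)) h
    have h2 := (hz' i).imp_right fun h => mul_eq_zero_of_right (2 * (2 * (k : ℝ) - 1)) h
    rcases h1 with h1 | h1 <;> rcases h2 with h2 | h2 <;> linarith
  funext ⟨i, j⟩
  fin_cases j
  · have := comb_pt_inl w i
    rw [h, comb_pt_inl, hb, h1 i] at this
    exact (add_right_cancel this).symm
  · exact h1 i
  · have := comb_pt_inr w i
    rw [h, comb_pt_inr, hb, h1 i] at this
    exact (add_right_cancel this).symm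

/-- Intermediate value theorem between half the least `t i`, where all summands vanish, and `T = ∑ t
i`, where the left side exceeds the right by at least `(2k - 2) T ≥ 0`. The left endpoint is what
gives `t i ≤ 2 b` for the minimizing index. -/
theorem exists_sum_max_eq [NeZero k] (t : Fin k → ℝ) (ht : ∀ i, 0 ≤ t i) :
    ∃ b, ∑ i, max (2 * b - t i) 0 = b ∧ ∃ i, t i ≤ 2 * b := by
  obtain ⟨i₀, -, hi₀⟩ := Finset.exists_min_image univ t ⟨0, Finset.mem_univ _⟩
  have hk : (1 : ℝ) ≤ k := by exact_mod_cast NeZero.one_le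
  have hle : t i₀ / 2 ≤ ∑ i, t i := by
    have := Finset.single_le_sum (fun i _ => ht i) (Finset.mem_univ i₀)
    linarith [ht i₀]
  have hc : Continuous fun b : ℝ => ∑ i, max (2 * b - t i) 0 - b := by fun_prop
  have h1 : ∑ i, max (2 * (t i₀ / 2) - t i) 0 - t i₀ / 2 ≤ 0 := by
    rw [Finset.sum_eq_zero fun i hi => max_eq_right (by linarith [hi₀ i hi])]
    linarith [ht i₀]
  have h2 : 0 ≤ ∑ i, max (2 * (∑ i, t i) - t i) 0 - ∑ i, t i := by
    have h3 : ∑ i, (2 * (∑ i, t i) - t i) ≤ ∑ i, max (2 * (∑ i, t i) - t i) 0 :=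
      Finset.sum_le_sum fun i _ => le_max_left _ _
    rw [Finset.sum_sub_distrib, Finset.sum_const, Finset.card_univ, Fintype.card_fin,
      nsmul_eq_mul] at h3
    have h4 : 0 ≤ ∑ i, t i := Finset.sum_nonneg fun i _ => ht i
    nlinarith
  obtain ⟨b, hb, hfb⟩ := intermediate_value_Icc hle hc.continuousOn ⟨h1, h2⟩
  exact ⟨b, sub_eq_zero.1 hfb, i₀, by linarith [hb.1]⟩

theorem image_comb_pt (hk : 2 ≤ k) :
    comb (pt k) '' graphWeights (goodGraphs k) = stdSimplex ℝ (Fin k ⊕ Fin k) := by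
  have hk' : (2 : ℝ) ≤ k := by exact_mod_cast hk
  have hn : 0 < 2 * (2 * (k : ℝ) - 1) := by linarith
  have hn' : 2 * (k : ℝ) - 1 ≠ 0 := by linarith
  have : NeZero k := ⟨by omega⟩
  refine Set.Subset.antisymm ?_ fun z hz => ?_
  · rintro _ ⟨w, hw, rfl⟩
    exact comb_pt_mem_stdSimplex hk (mem_graphWeights.1 hw).1
  set m : Fin k → ℝ := fun i => min (z (Sum.inl i)) (z (Sum.inr i))
  obtain ⟨b, hb, i₀, hi₀⟩ := exists_sum_max_eq (fun i => 2 * (2 * (k : ℝ) - 1) * m i)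
    fun i => mul_nonneg hn.le (le_min (hz.1 _) (hz.1 _))
  -- `β` and `d` are the negative and positive parts forced by complementarity; the factor `1 / 2n`
  -- rescales between them.
  set β : Fin k → ℝ := fun i => max (2 * b - 2 * (2 * (k : ℝ) - 1) * m i) 0
  set d : Fin k → ℝ := fun i => max (m i - 1 / (2 * (2 * (k : ℝ) - 1)) * (2 * b)) 0
  have hmul : ∀ i, 2 * (2 * (k : ℝ) - 1) * (m i - 1 / (2 * (2 * (k : ℝ) - 1)) * (2 * b)) =
      2 * (2 * (k : ℝ) - 1) * m i - 2 * b := fun i => by field_simp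
  have hcases : ∀ i, (d i = 0 ∨ β i = 0) ∧
      d i + 1 / (2 * (2 * (k : ℝ) - 1)) * (2 * b - β i) = m i := fun i => by
    rcases le_total (2 * (2 * (k : ℝ) - 1) * m i) (2 * b) with h | h
    · have h1 : d i = 0 := max_eq_right (by
        by_contra! hc
        have := mul_pos hn hc
        rw [hmul] at this
        linarith)
      have h2 : β i = 2 * b - 2 * (2 * (k : ℝ) - 1) * m i := max_eq_left (by linarith)
      refine ⟨Or.inl h1, ?_⟩
      rw [h1, h2]
      field_simp
      ring
    · have h1 : d i = m i - 1 / (2 * (2 * (k : ℝ) - 1)) * (2 * b) := max_eq_left (by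
        by_contra! hc
        have := mul_neg_of_pos_of_neg hn hc
        rw [hmul] at this
        linarith)
      have h2 : β i = 0 := max_eq_right (by linarith)
      refine ⟨Or.inr h2, ?_⟩
      rw [h1, h2]
      ring
  -- This index keeps the omitted graph from being constantly `1`.
  have hd₀ : d i₀ = 0 := by
    refine max_eq_right ?_
    by_contra! hc
    have := mul_pos hn hc
    rw [hmul] at this
    linarith
  -- The larger of the two coordinates at `i` has its excess over `m i` added to the corresponding
  -- `A` or `C` weight.
  let w : Fin k × Fin 3 → ℝ := fun i =>
    ![d i.1 + (z (Sum.inl i.1) - m i.1), β i.1, d i.1 + (z (Sum.inr i.1) - m i.1)] i.2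
  have hw : comb (pt k) w = z := by
    funext i
    rcases i with i | i
    · rw [comb_pt_inl]
      change d i + (z (Sum.inl i) - m i) + 1 / (2 * (2 * (k : ℝ) - 1)) * (2 * ∑ i, β i - β i) = _
      rw [hb]
      linarith [(hcases i).2]
    · rw [comb_pt_inr]
      change d i + (z (Sum.inr i) - m i) + 1 / (2 * (2 * (k : ℝ) - 1)) * (2 * ∑ i, β i - β i) = _
      rw [hb]
      linarith [(hcases i).2]
  have hz0 : ∀ i, d i = 0 → w (i, 0) = 0 ∨ w (i, 2) = 0 := fun i hi => by
    change d i + (z (Sum.inl i) - m i) = 0 ∨ d i + (z (Sum.inr i) - m i) = 0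
    rw [hi, zero_add, zero_add, sub_eq_zero, sub_eq_zero, eq_comm, @eq_comm _ (z (Sum.inr i))]
    exact min_choice _ _
  have hex : ∀ i, ∃ a, w (i, a) = 0 ∧ (d i = 0 → a ≠ 1) := fun i => by
    by_cases hi : d i = 0
    · rcases hz0 i hi with h | h
      · exact ⟨0, h, fun _ => by decide⟩
      · exact ⟨2, h, fun _ => by decide⟩
    · exact ⟨1, (hcases i).1.resolve_left hi, fun h => absurd h hi⟩
  choose g hg hg1 using hex
  refine ⟨w, mem_graphWeights.2 ⟨⟨?_, by rw [← sum_comb_pt hk, hw, hz.2]⟩, g, ?_, hg⟩, hw⟩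
  · rintro ⟨i, a⟩
    fin_cases a
    · exact add_nonneg (le_max_right _ _) (sub_nonneg.2 (min_le_left _ _))
    · exact le_max_right _ _
    · exact add_nonneg (le_max_right _ _) (sub_nonneg.2 (min_le_right _ _))
  · intro h
    exact hg1 i₀ hd₀ (congrFun h i₀)

theorem single_mem_graphWeights (hk : 2 ≤ k) (i : Fin k × Fin 3) :
    Pi.single i 1 ∈ graphWeights (goodGraphs k) := by
  rw [mem_graphWeights]
  have h : ∀ a : Fin 3, a ≠ 1 → i.2 ≠ a → ∃ g ∈ goodGraphs k, ∀ j,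
      (Pi.single i 1 : Fin k × Fin 3 → ℝ) (j, g j) = 0 := fun a ha hia =>
    ⟨fun _ => a, fun h => ha (congrFun h ⟨0, by omega⟩), fun j =>
      Pi.single_eq_of_ne (fun h => hia (congrArg Prod.snd h).symm) _⟩
  refine ⟨single_mem_stdSimplex ℝ i, ?_⟩
  by_cases hi : i.2 = 0
  · exact h 2 (by decide) (by rw [hi]; decide)
  · exact h 0 (by decide) hi

theorem pt_injective (hk : 2 ≤ k) : Function.Injective (pt k) := by
  intro i j h
  have := injOn_comb_pt hk (single_mem_graphWeights hk i) (single_mem_graphWeights hk j)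
    (by simp [h])
  by_contra hne
  have h2 := congrFun this i
  rw [Pi.single_eq_same, Pi.single_eq_of_ne hne] at h2
  exact one_ne_zero h2

end Points

/-! ### Good sets as complements of graphs: counting and triangulation. -/

section GoodSets

variable {k : ℕ}

theorem isGood_iff (hk : 2 ≤ k) {S : Finset (Space k)} :
    IsGood k S ↔ ∃ g ∈ goodGraphs k, (avoid g).image (pt k) = S := by
  have hinj := pt_injective hk
  have hAC : setA k ∪ setC k = (avoid fun _ => 1).image (pt k) := by
    ext x
    simp only [setA, setC, Finset.mem_union, Finset.mem_image, Finset.mem_univ, true_and,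
      mem_avoid, Prod.exists]
    constructor
    · rintro (⟨i, rfl⟩ | ⟨i, rfl⟩)
      · exact ⟨i, 0, by decide, rfl⟩
      · exact ⟨i, 2, by decide, rfl⟩
    · rintro ⟨i, a, ha, rfl⟩
      fin_cases a
      · exact Or.inl ⟨i, rfl⟩
      · exact absurd rfl ha
      · exact Or.inr ⟨i, rfl⟩
  have hABC : setA k ∪ setB k ∪ setC k = Finset.univ.image (pt k) := by
    ext x
    simp only [setA, setB, setC, Finset.mem_union, Finset.mem_image, Finset.mem_univ, true_and,
      Prod.exists]
    constructor
    · rintro ((⟨i, rfl⟩ | ⟨i, rfl⟩) | ⟨i, rfl⟩)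
      exacts [⟨i, 0, rfl⟩, ⟨i, 1, rfl⟩, ⟨i, 2, rfl⟩]
    · rintro ⟨i, a, rfl⟩
      fin_cases a
      exacts [Or.inl (Or.inl ⟨i, rfl⟩), Or.inl (Or.inr ⟨i, rfl⟩), Or.inr ⟨i, rfl⟩]
  constructor
  · rintro ⟨hsub, hcard, htriple, hne⟩
    rw [hABC] at hsub
    obtain ⟨T, -, rfl⟩ := Finset.subset_image_iff.1 hsub
    rw [Finset.card_image_of_injective _ hinj] at hcard
    have hex : ∀ i, ∃ a, (i, a) ∉ T := fun i => by
      by_contra! h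
      exact htriple i ⟨Finset.mem_image_of_mem (pt k) (h 0), Finset.mem_image_of_mem (pt k) (h 1),
        Finset.mem_image_of_mem (pt k) (h 2)⟩
    choose g hg using hex
    -- At least one index is missing over each `i`, and the cardinality `2 * k` leaves room for no
    -- more.
    have hT : T = avoid g := by
      refine Finset.eq_of_subset_of_card_le (fun i hi => mem_avoid.2 fun h => hg i.1 ?_) ?_
      · rw [← h]; exact hi
      · rw [card_avoid, hcard]
    subst hT
    refine ⟨g, ?_, rfl⟩
    rintro rfl
    exact hne hAC.symm
  · rintro ⟨g, hg, rfl⟩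
    refine ⟨?_, ?_, fun i hi => ?_, fun h => hg ?_⟩
    · rw [hABC]; exact Finset.image_subset_image (Finset.subset_univ _)
    · rw [Finset.card_image_of_injective _ hinj, card_avoid]
    · have : ∀ a, (i, a) ∈ avoid g := fun a => by
        rw [← hinj.mem_finset_image]
        fin_cases a
        exacts [hi.1, hi.2.1, hi.2.2]
      exact mem_avoid.1 (this (g i)) rfl
    · exact avoid_injective (Finset.image_injective hinj (h.trans hAC))

theorem setOf_isGood (hk : 2 ≤ k) :
    {S | IsGood k S} = (fun T => T.image (pt k)) '' (avoid '' goodGraphs k) := by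
  ext S
  simp [isGood_iff hk]

theorem ncard_isGood (hk : 2 ≤ k) : {S | IsGood k S}.ncard = 3 ^ k - 1 := by
  rw [setOf_isGood hk, Set.ncard_image_of_injective _ (Finset.image_injective (pt_injective hk)),
    Set.ncard_image_of_injective _ avoid_injective]
  have : goodGraphs k = {fun _ => 1}ᶜ := rfl
  rw [this, Set.ncard_compl, Set.ncard_singleton, Nat.card_eq_fintype_card, Fintype.card_fun,
    Fintype.card_fin, Fintype.card_fin]

theorem isSimplex_image_avoid (hk : 2 ≤ k) {g : Fin k → Fin 3}
    (h : InjOn (comb (pt k)) (faceWeights (avoid g))) :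
    IsSimplex (2 * k - 1) ((avoid g).image (pt k)) := by
  refine ⟨?_, affineIndependent_coe_image h⟩
  rw [Finset.card_image_of_injective _ (pt_injective hk), card_avoid]
  omega

theorem isSimplex_of_isGood (hk : 2 ≤ k) {S : Finset (Space k)} (hS : IsGood k S) :
    IsSimplex (2 * k - 1) S := by
  obtain ⟨g, hg, rfl⟩ := (isGood_iff hk).1 hS
  exact isSimplex_image_avoid hk
    ((injOn_comb_pt hk).mono (faceWeights_subset_familyWeights (Set.mem_image_of_mem _ hg)))

theorem exists_triangulation (hk : 2 ≤ k) :
    ∃ K : Geometry.SimplicialComplex ℝ (Space k),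
      K.facets = {S | IsGood k S} ∧ K.space = stdSimplex ℝ (Fin k ⊕ Fin k) := by
  refine ⟨complexOfFamily (pt k) (pt_injective hk) (avoid '' goodGraphs k) (injOn_comb_pt hk),
    ?_, ?_⟩
  · rw [complexOfFamily_facets _ _ _ _ (m := 2 * k) (by omega), setOf_isGood hk]
    rintro _ ⟨g, -, rfl⟩
    exact card_avoid g
  · rw [complexOfFamily_space, image_comb_pt hk]

end GoodSets

/-! ### The modular block as the union of the simplices of nonconstant graphs. -/

section Block

variable {k : ℕ}

/-- The vertex sets of the simplices bounded by the terminals. -/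
noncomputable def terminal (k : ℕ) (j : Fin 3) : Finset (Space k) :=
  (avoid fun _ => j + 1).image (pt k)

theorem terminal_zero : terminal k 0 = stdVertices k := by
  have hA : ∀ i, ptA k i = Pi.single (Sum.inl i) 1 := fun i => by
    funext x; rcases x with x | x <;> simp [ptA, Pi.single_apply]
  have hC : ∀ i, ptC k i = Pi.single (Sum.inr i) 1 := fun i => by
    funext x; rcases x with x | x <;> simp [ptC, Pi.single_apply]
  ext x
  simp only [terminal, stdVertices, Finset.mem_image, Finset.mem_univ, true_and, mem_avoid,
    Prod.exists, zero_add, Sum.exists, ← hA, ← hC]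
  constructor
  · rintro ⟨i, a, ha, rfl⟩
    fin_cases a
    · exact Or.inl ⟨i, rfl⟩
    · exact absurd rfl ha
    · exact Or.inr ⟨i, rfl⟩
  · rintro (⟨i, rfl⟩ | ⟨i, rfl⟩)
    · exact ⟨i, 0, by decide, rfl⟩
    · exact ⟨i, 2, by decide, rfl⟩

theorem terminal_one : terminal k 1 = setA k ∪ setB k := by
  ext x
  simp only [terminal, setA, setB, Finset.mem_union, Finset.mem_image, Finset.mem_univ, true_and,
    mem_avoid, Prod.exists]
  constructor
  · rintro ⟨i, a, ha, rfl⟩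
    fin_cases a
    · exact Or.inl ⟨i, rfl⟩
    · exact Or.inr ⟨i, rfl⟩
    · exact absurd rfl ha
  · rintro (⟨i, rfl⟩ | ⟨i, rfl⟩)
    · exact ⟨i, 0, by decide, rfl⟩
    · exact ⟨i, 1, by decide, rfl⟩

theorem terminal_two : terminal k 2 = setB k ∪ setC k := by
  ext x
  simp only [terminal, setB, setC, Finset.mem_union, Finset.mem_image, Finset.mem_univ, true_and,
    mem_avoid, Prod.exists]
  constructor
  · rintro ⟨i, a, ha, rfl⟩
    fin_cases a
    · exact absurd rfl ha
    · exact Or.inl ⟨i, rfl⟩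
    · exact Or.inr ⟨i, rfl⟩
  · rintro (⟨i, rfl⟩ | ⟨i, rfl⟩)
    · exact ⟨i, 1, by decide, rfl⟩
    · exact ⟨i, 2, by decide, rfl⟩

theorem mem_faceWeights_avoid_const {a : Fin 3} {w : Fin k × Fin 3 → ℝ} :
    w ∈ faceWeights (avoid fun _ => a) ↔ w ∈ stdSimplex ℝ _ ∧ ∀ i, w (i, a) = 0 := by
  refine and_congr_right fun _ => ⟨fun h i => h _ (by simp), fun h ⟨i, b⟩ hi => ?_⟩
  obtain rfl : b = a := by simpa using hi
  exact h i

theorem convexHull_terminal (j : Fin 3) :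
    convexHull ℝ (terminal k j : Set (Space k)) =
      comb (pt k) '' faceWeights (avoid fun _ => j + 1) := by
  rw [terminal, Finset.coe_image, convexHull_image_eq]

theorem convexHull_terminal_zero :
    convexHull ℝ (terminal k 0 : Set (Space k)) = stdSimplex ℝ (Fin k ⊕ Fin k) := by
  rw [terminal_zero, stdVertices, Finset.coe_image, Finset.coe_univ, Set.image_univ,
    convexHull_rangle_single_eq_stdSimplex]

/-- The functions whose avoiding sets index the maximal simplices of the block. -/
abbrev blockGraphs (k : ℕ) : Set (Fin k → Fin 3) := {g | ∀ a, g ≠ fun _ => a}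

theorem blockGraphs_subset : blockGraphs k ⊆ goodGraphs k := fun _ hg => hg 1

theorem faceWeights_subset_graphWeights (hk : 2 ≤ k) {a : Fin 3} (ha : a ≠ 1) :
    faceWeights (avoid fun _ : Fin k => a) ⊆ graphWeights (goodGraphs k) :=
  faceWeights_subset_familyWeights
    ⟨_, fun h => ha (congrFun h (⟨0, by omega⟩ : Fin k)), rfl⟩

theorem injOn_comb_pt_avoid_const (hk : 2 ≤ k) (a : Fin 3) :
    InjOn (comb (pt k)) (faceWeights (avoid fun _ => a)) := by
  by_cases ha : a = 1
  · subst ha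
    intro w hw w' hw' h
    have h1 := (mem_faceWeights_avoid_const.1 hw).2
    have h1' := (mem_faceWeights_avoid_const.1 hw').2
    funext ⟨i, b⟩
    fin_cases b
    · have := comb_pt_inl w i
      rw [h, comb_pt_inl] at this
      simpa [h1, h1'] using this.symm
    · exact (h1 i).trans (h1' i).symm
    · have := comb_pt_inr w i
      rw [h, comb_pt_inr] at this
      simpa [h1, h1'] using this.symm
  · exact (injOn_comb_pt hk).mono (faceWeights_subset_graphWeights hk ha)

/-- The weights of the points of the boundary of a terminal simplex. -/
def bdryWeights (k : ℕ) (a : Fin 3) : Set (Fin k × Fin 3 → ℝ) :=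
  ⋃ i ∈ avoid (fun _ : Fin k => a), faceWeights ((avoid fun _ => a).erase i)

theorem bdry_terminal (hk : 2 ≤ k) (j : Fin 3) :
    bdry (terminal k j) = comb (pt k) '' bdryWeights k (j + 1) :=
  bdry_image (pt_injective hk) _

theorem mem_bdryWeights {a : Fin 3} {w : Fin k × Fin 3 → ℝ} :
    w ∈ bdryWeights k a ↔
      w ∈ faceWeights (avoid fun _ => a) ∧ ∃ i b, b ≠ a ∧ w (i, b) = 0 := by
  simp only [bdryWeights, Set.mem_iUnion, exists_prop, Prod.exists, mem_avoid]
  constructor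
  · rintro ⟨i, b, hb, hw⟩
    exact ⟨faceWeights_mono (Finset.erase_subset _ _) hw, i, b, hb, hw.2 _ (by simp)⟩
  · rintro ⟨hw, i, b, hb, h⟩
    refine ⟨i, b, hb, hw.1, fun x hx => ?_⟩
    by_cases hxi : x = (i, b)
    · rw [hxi, h]
    · exact hw.2 x fun hx' => hx (Finset.mem_erase.2 ⟨hxi, hx'⟩)

/-- On a proper face, one further weight `(i, b)` vanishes. Changing the constant graph `a` to `b`
at `i` keeps it inside the zero set and, since `k ≥ 2`, makes it nonconstant. -/
theorem bdryWeights_subset (hk : 2 ≤ k) (a : Fin 3) :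
    bdryWeights k a ⊆ graphWeights (blockGraphs k) := by
  have : Nontrivial (Fin k) := Fin.nontrivial_iff_two_le.2 hk
  intro w hw
  obtain ⟨hw, i, b, hb, h⟩ := mem_bdryWeights.1 hw
  rw [mem_faceWeights_avoid_const] at hw
  refine mem_graphWeights.2 ⟨hw.1, Function.update (fun _ => a) i b, fun c hc => ?_, fun j => ?_⟩
  · obtain ⟨j, hj⟩ := exists_ne i
    have h1 := congrFun hc i
    have h2 := congrFun hc j
    rw [Function.update_self] at h1
    rw [Function.update_of_ne hj] at h2
    exact hb (h1.trans h2.symm)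
  · by_cases hj : j = i
    · subst hj; rw [Function.update_self, h]
    · rw [Function.update_of_ne hj, hw.2]

theorem injOn_comb_pt_blockGraphs (hk : 2 ≤ k) :
    InjOn (comb (pt k)) (graphWeights (blockGraphs k)) :=
  (injOn_comb_pt hk).mono (graphWeights_mono blockGraphs_subset)

/-- The weights of the points of the outer simplex outside the two inner ones. -/
def outsideWeights (k : ℕ) : Set (Fin k × Fin 3 → ℝ) :=
  {w | w ∈ graphWeights (goodGraphs k) ∧ (∃ i, w (i, 2) ≠ 0) ∧ ∃ i, w (i, 0) ≠ 0}

theorem image_outsideWeights (hk : 2 ≤ k) :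
    comb (pt k) '' outsideWeights k =
      (convexHull ℝ (terminal k 0 : Set (Space k)) \ convexHull ℝ (terminal k 1)) \
        convexHull ℝ (terminal k 2) := by
  have h1 : ((1 : Fin 3) + 1) = 2 := rfl
  have h2 : ((2 : Fin 3) + 1) = 0 := rfl
  rw [convexHull_terminal_zero, ← image_comb_pt hk, convexHull_terminal, convexHull_terminal,
    h1, h2]
  ext x
  constructor
  · rintro ⟨w, ⟨hw, ⟨i, hi⟩, ⟨j, hj⟩⟩, rfl⟩
    have key : ∀ a : Fin 3, a ≠ 1 → (∃ i, w (i, a) ≠ 0) →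
        comb (pt k) w ∉ comb (pt k) '' faceWeights (avoid fun _ => a) := by
      rintro a ha ⟨i, hi⟩ ⟨w', hw', h⟩
      obtain rfl := injOn_comb_pt hk (faceWeights_subset_graphWeights hk ha hw') hw h
      exact hi ((mem_faceWeights_avoid_const.1 hw').2 i)
    exact ⟨⟨⟨w, hw, rfl⟩, key 2 (by decide) ⟨i, hi⟩⟩, key 0 (by decide) ⟨j, hj⟩⟩
  · rintro ⟨⟨⟨w, hw, rfl⟩, hx1⟩, hx2⟩
    have hs := (mem_graphWeights.1 hw).1
    refine ⟨w, ⟨hw, ?_, ?_⟩, rfl⟩ <;> by_contra! h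
    · exact hx1 ⟨w, mem_faceWeights_avoid_const.2 ⟨hs, h⟩, rfl⟩
    · exact hx2 ⟨w, mem_faceWeights_avoid_const.2 ⟨hs, h⟩, rfl⟩

/-- Points of the block lying in a removed simplex are limits of points outside both. The weight `w`
lies in a good face that also contains the vertices `(i, a)` and `(j, b)`; moving slightly towards
their midpoint `v` makes both weights positive. -/
theorem mem_closure_outsideWeights (hk : 2 ≤ k) {w : Fin k × Fin 3 → ℝ} {a b : Fin 3} (ha : a ≠ 1)
    (hab : a ≠ b) (hw : w ∈ graphWeights (blockGraphs k)) (h : ∀ i, w (i, a) = 0) :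
    w ∈ closure {w | w ∈ graphWeights (goodGraphs k) ∧ (∃ i, w (i, a) ≠ 0) ∧
      ∃ i, w (i, b) ≠ 0} := by
  have : Nontrivial (Fin k) := Fin.nontrivial_iff_two_le.2 hk
  obtain ⟨hs, g, hg, hwg⟩ := mem_graphWeights.1 hw
  obtain ⟨i, hi⟩ : ∃ i, g i ≠ a := by
    by_contra! hc
    exact hg a (funext hc)
  obtain ⟨j, hj⟩ := exists_ne i
  set v : Fin k × Fin 3 → ℝ :=
    (1 / 2 : ℝ) • Pi.single (i, a) 1 + (1 / 2 : ℝ) • Pi.single (j, b) 1 with hv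
  set g' : Fin k → Fin 3 := Function.update (fun _ => a) i (g i) with hg'
  have hgood : g' ∈ goodGraphs k := fun hc => ha <| by
    have := congrFun hc j
    rwa [hg', Function.update_of_ne hj] at this
  have hwF : w ∈ faceWeights (avoid g') := by
    refine ⟨hs, fun ⟨l, c⟩ hl => ?_⟩
    obtain rfl : c = g' l := by simpa using hl
    by_cases hli : l = i
    · subst hli; rw [hg', Function.update_self, hwg]
    · rw [hg', Function.update_of_ne hli, h]
  have hvF : v ∈ faceWeights (avoid g') := by
    refine convex_faceWeights _ (single_mem_faceWeights ?_) (single_mem_faceWeights ?_)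
      (by norm_num) (by norm_num) (by norm_num)
    · rw [mem_avoid, hg', Function.update_self]; exact hi.symm
    · rw [mem_avoid, hg', Function.update_of_ne hj]; exact hab.symm
  refine closure_mono ?_ (segment_subset_closure_openSegment (left_mem_segment ℝ w v))
  rintro _ ⟨s, t, hs0, ht0, hst, rfl⟩
  have hpos : ∀ x, 0 < v x → (s • w + t • v) x ≠ 0 := fun x hx =>
    (add_pos_of_nonneg_of_pos (mul_nonneg hs0.le (hs.1 x)) (mul_pos ht0 hx)).ne'
  refine ⟨faceWeights_subset_familyWeights (Set.mem_image_of_mem _ hgood)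
    (convex_faceWeights _ hwF hvF hs0.le ht0.le hst), ⟨i, hpos _ ?_⟩, ⟨j, hpos _ ?_⟩⟩
  · simp [hv, hj.symm]
  · simp [hv, hj]

/-- Outside the inner simplices, the graph cannot be constantly `0` or `2`, and goodness excludes
`1`. The weights of nonconstant graphs form a compact set, so the closure adds nothing else;
conversely each of them is a limit of outside weights. -/
theorem region_terminal (hk : 2 ≤ k) :
    region (terminal k) = comb (pt k) '' graphWeights (blockGraphs k) := by
  have hc : Continuous (comb (pt k)) := LinearMap.continuous_on_pi _
  rw [region, ← image_outsideWeights hk]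
  refine (closure_minimal (Set.image_mono ?_)
    ((isCompact_familyWeights _).image hc).isClosed).antisymm
    ((Set.image_mono ?_).trans (image_closure_subset_closure_image hc))
  · rintro w ⟨hw, ⟨i, hi⟩, ⟨j, hj⟩⟩
    obtain ⟨hs, g, hg, h⟩ := mem_graphWeights.1 hw
    refine mem_graphWeights.2 ⟨hs, g, fun a ha => ?_, h⟩
    subst ha
    fin_cases a
    · exact hj (h j)
    · exact hg rfl
    · exact hi (h i)
  · intro w hw
    by_cases h2 : ∀ i, w (i, 2) = 0
    · exact mem_closure_outsideWeights hk (by decide) (by decide) hw h2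
    · by_cases h0 : ∀ i, w (i, 0) = 0
      · have := mem_closure_outsideWeights hk (b := 2) (by decide) (by decide) hw h0
        simpa only [outsideWeights, and_comm] using this
      · push Not at h0 h2
        exact subset_closure ⟨graphWeights_mono blockGraphs_subset hw, h2, h0⟩

theorem coe_terminal_inter (hk : 2 ≤ k) (i j : Fin 3) :
    (terminal k i : Set (Space k)) ∩ terminal k j =
      pt k '' ((avoid fun _ => i + 1) ∩ avoid fun _ => j + 1 : Finset (Fin k × Fin 3)) := by
  rw [terminal, terminal, Finset.coe_image, Finset.coe_image, ← Set.image_inter (pt_injective hk),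
    Finset.coe_inter]

theorem card_avoid_inter {a b : Fin 3} (hab : a ≠ b) :
    ((avoid fun _ : Fin k => a) ∩ avoid fun _ => b).card = k := by
  have h : ∀ a b : Fin 3, a ≠ b → ∑ j : Fin 3, (if j ≠ a ∧ j ≠ b then 1 else 0) = 1 := by decide
  rw [avoid, avoid, ← Finset.filter_and, Finset.card_filter, Fintype.sum_prod_type]
  simp only [h a b hab, Finset.sum_const, Finset.card_univ, Fintype.card_fin, smul_eq_mul, mul_one]

theorem faceWeights_inter_subset_bdryWeights (hk : 2 ≤ k) {a b : Fin 3} (hab : a ≠ b) :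
    faceWeights (avoid fun _ : Fin k => a) ∩ faceWeights (avoid fun _ => b) ⊆ bdryWeights k a :=
  fun _ hw => mem_bdryWeights.2 ⟨hw.1, ⟨0, by omega⟩, b, hab.symm,
    (mem_faceWeights_avoid_const.1 hw.2).2 _⟩

theorem bdry_terminal_inter (hk : 2 ≤ k) {i j : Fin 3} (hij : i ≠ j) :
    bdry (terminal k i) ∩ bdry (terminal k j) =
      convexHull ℝ ((terminal k i : Set (Space k)) ∩ terminal k j) := by
  have hab : i + 1 ≠ j + 1 := fun h => hij (add_right_cancel h)
  rw [coe_terminal_inter hk, convexHull_image_eq, bdry_terminal hk, bdry_terminal hk,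
    ← (injOn_comb_pt_blockGraphs hk).image_inter (bdryWeights_subset hk _)
      (bdryWeights_subset hk _), faceWeights_inter]
  congr 1
  refine Set.Subset.antisymm
    (fun w hw => ⟨(mem_bdryWeights.1 hw.1).1, (mem_bdryWeights.1 hw.2).1⟩)
    (Set.subset_inter (faceWeights_inter_subset_bdryWeights hk hab) ?_)
  rw [Set.inter_comm]
  exact faceWeights_inter_subset_bdryWeights hk hab.symm

/-- Both inner simplices belong to the triangulation, so a common point has the same weights in
each. Those weights lie in both faces, hence on the boundary. -/
theorem disjoint_inner_terminal (hk : 2 ≤ k) :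
    Disjoint (inner (terminal k 1)) (inner (terminal k 2)) := by
  rw [Set.disjoint_left]
  rintro x ⟨hx, hx'⟩ ⟨hy, -⟩
  rw [convexHull_terminal] at hx hy
  rw [bdry_terminal hk] at hx'
  obtain ⟨w, hw, rfl⟩ := hx
  obtain ⟨w', hw', h⟩ := hy
  obtain rfl := injOn_comb_pt hk (faceWeights_subset_graphWeights hk (by decide) hw')
    (faceWeights_subset_graphWeights hk (by decide) hw) h
  exact hx' ⟨_, faceWeights_inter_subset_bdryWeights hk (by decide) ⟨hw, hw'⟩, rfl⟩

/-! ### The symmetry of order 3. -/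

/-- The permutation of the indices that sends `A j` to `B j`, `B j` to `C j` and `C j` to `A j`. -/
def rotation (k : ℕ) : Equiv.Perm (Fin k × Fin 3) :=
  Equiv.prodCongr (Equiv.refl _) (Equiv.addRight 1)

theorem rotation_apply (i : Fin k × Fin 3) : rotation k i = (i.1, i.2 + 1) := rfl

theorem rotation_symm_apply (i : Fin k × Fin 3) : (rotation k).symm i = (i.1, i.2 - 1) := by
  rw [Equiv.symm_apply_eq, rotation_apply, sub_add_cancel]

theorem image_rotation_avoid (a : Fin 3) :
    (avoid fun _ : Fin k => a).image (rotation k) = avoid fun _ => a + 1 := by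
  ext ⟨i, b⟩
  have h : (i, b) = rotation k (i, b - 1) := by rw [rotation_apply, sub_add_cancel]
  rw [mem_avoid, h, (rotation k).injective.mem_finset_image, mem_avoid]
  exact not_congr (add_left_inj 1).symm

theorem comp_perm_mem_stdSimplex {ι : Type*} [Fintype ι] {w : ι → ℝ}
    (hw : w ∈ stdSimplex ℝ ι)
    (ρ : Equiv.Perm ι) : w ∘ ρ ∈ stdSimplex ℝ ι :=
  ⟨fun _ => hw.1 _, (Equiv.sum_comp ρ w).trans hw.2⟩

theorem comp_rotation_symm_mem {w : Fin k × Fin 3 → ℝ} (hw : w ∈ graphWeights (blockGraphs k)) :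
    w ∘ (rotation k).symm ∈ graphWeights (blockGraphs k) := by
  obtain ⟨hs, g, hg, h⟩ := mem_graphWeights.1 hw
  refine mem_graphWeights.2 ⟨comp_perm_mem_stdSimplex hs _, fun i => g i + 1, fun a ha => ?_,
    fun i => ?_⟩
  · exact hg (a - 1) (funext fun i => eq_sub_of_add_eq (congrFun ha i))
  · rw [Function.comp_apply, rotation_symm_apply, add_sub_cancel_right, h]

theorem comp_rotation_mem {w : Fin k × Fin 3 → ℝ} (hw : w ∈ graphWeights (blockGraphs k)) :
    w ∘ rotation k ∈ graphWeights (blockGraphs k) := by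
  obtain ⟨hs, g, hg, h⟩ := mem_graphWeights.1 hw
  refine mem_graphWeights.2 ⟨comp_perm_mem_stdSimplex hs _, fun i => g i - 1, fun a ha => ?_,
    fun i => ?_⟩
  · exact hg (a + 1) (funext fun i => eq_add_of_sub_eq (congrFun ha i))
  · rw [Function.comp_apply, rotation_apply, sub_add_cancel, h]

theorem exists_symm_terminal (hk : 2 ≤ k) :
    ∃ σ : region (terminal k) ≃ₜ region (terminal k), orderOf σ = 3 ∧ IsPL σ ∧
      ∀ j, ∃ f : Space k →ᵃ[ℝ] Space k,
        (∀ x : region (terminal k), (x : Space k) ∈ bdry (terminal k j) → (σ x : Space k) = f x) ∧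
          f '' bdry (terminal k j) = bdry (terminal k (j + 1)) := by
  have hΩ := region_terminal hk
  have hinj := injOn_comb_pt_blockGraphs hk
  obtain ⟨σ, hσ⟩ := exists_homeomorph_comb (isCompact_familyWeights _) hinj hΩ (rotation k)
    (fun w => comp_rotation_symm_mem) fun w => comp_rotation_mem
  refine ⟨σ, ?_, ?_, fun j => ?_⟩
  · have : Fact (Nat.Prime 3) := ⟨Nat.prime_three⟩
    refine orderOf_eq_prime ?_ fun h1 => ?_
    · ext1 x
      obtain ⟨w, hw, hx⟩ := hΩ.subset x.2
      have e := hσ x w hw hx.symm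
      have e' := hσ _ _ (comp_rotation_symm_mem hw) e
      have e'' := hσ _ _ (comp_rotation_symm_mem (comp_rotation_symm_mem hw)) e'
      refine Subtype.ext (e''.trans ((congrArg (comb (pt k)) ?_).trans hx))
      have h3 : ∀ a : Fin 3, a - 1 - 1 - 1 = a := by decide
      funext i
      simp only [Function.comp_apply, rotation_symm_apply, h3]
    -- The vertex `A_i` lies on the outer boundary and is sent to `B_i`, so `σ` is not the identity.
    · let i : Fin k := ⟨0, by omega⟩
      have hw : Pi.single (i, 0) 1 ∈ bdryWeights k 1 := by
        refine mem_bdryWeights.2 ⟨single_mem_faceWeights (by simp), i, 2, by decide, ?_⟩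
        simp
      have hw := bdryWeights_subset hk 1 hw
      have e := hσ ⟨_, hΩ.superset ⟨_, hw, rfl⟩⟩ _ hw rfl
      rw [h1] at e
      have := congrFun (hinj hw (comp_rotation_symm_mem hw) e) (i, 0)
      simp [rotation_symm_apply] at this
  · refine ⟨complexOfFamily (pt k) (pt_injective hk) _ hinj, complexOfFamily_faces_finite _ _ _ _,
      by rw [complexOfFamily_space, hΩ], ?_⟩
    rintro _ ⟨S, T, hT, hST, -, rfl⟩
    have hsub := faceWeights_subset_familyWeights hT
    -- Permuting the weights amounts to keeping them and permuting the points, which is affine on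
    -- each simplex.
    obtain ⟨f, hf⟩ := exists_affineMap_comb (hinj.mono hsub) (pt k ∘ rotation k)
    refine ⟨f, fun x hx => ?_⟩
    rw [Finset.coe_image, convexHull_image_eq] at hx
    obtain ⟨w, hw, hwx⟩ := hx
    have hw := faceWeights_mono hST hw
    rw [hσ x w (hsub hw) hwx.symm, comb_comp_symm, ← hwx, hf w hw]
  -- The full terminal simplex is not a simplex of the block, but its vertices are affinely
  -- independent. One affine map therefore serves all its facets at once.
  · obtain ⟨f, hf⟩ := exists_affineMap_comb (injOn_comb_pt_avoid_const hk (j + 1))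
      (pt k ∘ rotation k)
    have hb : ∀ w ∈ bdryWeights k (j + 1), f (comb (pt k) w) = comb (pt k ∘ rotation k) w :=
      fun w hw => hf w (mem_bdryWeights.1 hw).1
    rw [bdry_terminal hk]
    refine ⟨f, ?_, ?_⟩
    · rintro x ⟨w, hw, hwx⟩
      rw [hσ x w (bdryWeights_subset hk _ hw) hwx.symm, comb_comp_symm, ← hwx, hb w hw]
    · rw [Set.image_image, Set.image_congr hb, terminal, ← image_rotation_avoid, Finset.image_image]
      exact (bdry_image ((pt_injective hk).comp (rotation k).injective) _).symm

theorem isModularBlock_terminal (hk : 2 ≤ k) : IsModularBlock k (terminal k) where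
  isSimplex j := isSimplex_image_avoid hk (injOn_comb_pt_avoid_const hk _)
  subset j := by
    rw [convexHull_terminal_zero, convexHull_terminal]
    rintro _ ⟨w, hw, rfl⟩
    exact comb_pt_mem_stdSimplex hk hw.1
  disjoint_inner := disjoint_inner_terminal hk
  card_common i j hij := by
    rw [coe_terminal_inter hk, Set.ncard_image_of_injective _ (pt_injective hk),
      Set.ncard_coe_finset, card_avoid_inter fun h => hij (add_right_cancel h)]
  bdry_inter i j hij := bdry_terminal_inter hk hij
  bdry_subset j := by
    rw [bdry_terminal hk, region_terminal hk]
    exact Set.image_mono (bdryWeights_subset hk _)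
  exists_symm := exists_symm_terminal hk

end Block

end ModularBlock

theorem mainTheorem5 (k : ℕ) (hk : 2 ≤ k) :
    (∃ V : Fin 3 → Finset (ModularBlock.Space k),
      ModularBlock.IsModularBlock k V ∧
      V 0 = ModularBlock.stdVertices k ∧
      V 1 = ModularBlock.setA k ∪ ModularBlock.setB k ∧
      V 2 = ModularBlock.setB k ∪ ModularBlock.setC k) ∧
    {S | ModularBlock.IsGood k S}.ncard = 3 ^ k - 1 ∧
    (∀ S, ModularBlock.IsGood k S → ModularBlock.IsSimplex (2 * k - 1) S) ∧
    ∃ K : Geometry.SimplicialComplex ℝ (ModularBlock.Space k),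
      K.facets = {S | ModularBlock.IsGood k S} ∧
      K.space = stdSimplex ℝ (Fin k ⊕ Fin k) :=
  ⟨⟨ModularBlock.terminal k, ModularBlock.isModularBlock_terminal hk, ModularBlock.terminal_zero,
    ModularBlock.terminal_one, ModularBlock.terminal_two⟩, ModularBlock.ncard_isGood hk,
    fun _ => ModularBlock.isSimplex_of_isGood hk, ModularBlock.exists_triangulation hk⟩
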